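/- A graph is a pair $\Gamma=(N,B)$ with $N$ a finite set and $B=(B_{ij})_{i,j\in N}$ a symmetric matrix of non-negative integers with zero diagonal. It is called a fission graph if it is the core diagram $\Gamma_c(E,\nabla)$ of some algebraic connection $(E,\nabla)$ on the affine line $\mathbb{A}^1(\mathbb{C})$ whose irregular class $\Theta=\sum_i n_i I_i$ at infinity is untwisted. Here the $I_i$ are the pairwise distinct Stokes circles (Galois orbits $\langle q\rangle$ of Puiseux polynomials $q=\sum_{k>0} a_k z^{k}$, $k\in\mathbb{Q}$) of the exponential factors $e^{q}$ of $(E,\nabla)$ at infinity, with multiplicities $n_i\geq 1$; $\Theta$ is untwisted if every $I_i=\langle q_i\rangle$ has ramification order $1$, i.e. every $q_i$ is a polynomial in $z$. The core diagram has the Stokes circles $I_i$ as its vertices, and its entries are the loop multiplicities $B_{I_i,I_i}$ and the edge multiplicities $B_{I_i,I_j}$ ($i\neq j$) of these circles; in the untwisted case $B_{I_i,I_i}=0$ and $B_{I_i,I_j}=\deg(q_i-q_j)-1$ for $i\neq j$. **Theorem.** Let $\Gamma=(N,B)$ be a graph. Then $\Gamma$ is a fission graph if and only if all its triangles are acute isosceles,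 i.e. for all pairwise distinct $i,j,k\in N$ the two largest of the three numbers $B_{ij}$, $B_{ik}$, $B_{jk}$ are equal. -/

import Mathlib

open Polynomial

noncomputable section

namespace NAH

/-! ### Diagrams and graphs -/

/-- A diagram on a vertex set `N`: a symmetric integer matrix with even diagonal entries.
For `i ≠ j` the entry `mult i j` is the number of edges between `i` and `j`, and `mult i i / 2`
is the number of loops at `i`; both may be negative. -/
structure Diagram (N : Type*) where
  mult : Matrix N N ℤ
  symm : mult.IsSymm
  even_diag : ∀ i, Even (mult i i)

/-- A graph: a diagram without loops and without negative edges. -/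
def Diagram.IsGraph {N : Type*} (Γ : Diagram N) : Prop :=
  (∀ i j, 0 ≤ Γ.mult i j) ∧ ∀ i, Γ.mult i i = 0

/-- Among the three edge multiplicities of `i, j, k`, the two largest are equal. -/
def Diagram.IsAcuteIsosceles {N : Type*} (Γ : Diagram N) (i j k : N) : Prop :=
  (Γ.mult i j ≤ Γ.mult i k ∧ Γ.mult i k = Γ.mult j k) ∨
  (Γ.mult i k ≤ Γ.mult j k ∧ Γ.mult j k = Γ.mult i j) ∨
  (Γ.mult j k ≤ Γ.mult i j ∧ Γ.mult i j = Γ.mult i k)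

/-! ### Exponential factors and Stokes circles at infinity -/

/-- An exponential factor at infinity: a Puiseux polynomial `∑ a_k z ^ k` with finitely many
exponents `k ∈ ℚ`, all of them positive. -/
@[ext]
structure ExpFactor where
  coeff : ℚ →₀ ℂ
  pos : ∀ k ∈ coeff.support, 0 < k

namespace ExpFactor

/-- The exponents of `q`: those `k` for which `z ^ k` occurs in `q`. -/
def exponents (q : ExpFactor) : Finset ℚ := q.coeff.support

/-- All exponents of `q` lie in `(1/r) ℤ`, i.e. `q` is a polynomial in `z ^ (1/r)`. -/
def HasDenominator (q : ExpFactor) (r : ℕ) : Prop :=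
  ∀ k ∈ q.exponents, ∃ m : ℕ, k = m / r

/-- The ramification order: the least `r ≥ 1` such that `q` is a polynomial in `z ^ (1/r)`. -/
def ram (q : ExpFactor) : ℕ := sInf {r : ℕ | 1 ≤ r ∧ q.HasDenominator r}

/-- The slope: the largest exponent of `q`, and `0` for `q = 0`. -/
def slope (q : ExpFactor) : ℚ := (insert 0 q.exponents).max' (Finset.insert_nonempty 0 _)

/-- `p` is a Galois conjugate of `q`: it is obtained by continuing `q` around infinity `m` times,
so that each `z ^ k` is multiplied by `exp (2 π i m k)`. -/
def IsConj (q p : ExpFactor) : Prop :=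
  ∃ m : ℤ, ∀ k : ℚ,
    p.coeff k = Complex.exp (2 * Real.pi * Complex.I * m * k) * q.coeff k

/-- The truncation `τ_k(q)`: the monomials of `q` with exponent `≥ k`. -/
def trunc (k : ℚ) (q : ExpFactor) : ExpFactor where
  coeff := q.coeff.filter (fun l => k ≤ l)
  pos l hl := q.pos l (by
    rw [Finsupp.support_filter] at hl
    exact Finset.filter_subset _ _ hl)

/-- The difference `q - τ_k(q)`: the monomials of `q` with exponent `< k`. -/
def tail (k : ℚ) (q : ExpFactor) : ExpFactor where
  coeff := q.coeff.filter (fun l => l < k)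
  pos l hl := q.pos l (by
    rw [Finsupp.support_filter] at hl
    exact Finset.filter_subset _ _ hl)

theorem IsConj.refl (q : ExpFactor) : IsConj q q := ⟨0, fun k => by simp⟩

theorem IsConj.symm {q p : ExpFactor} (h : IsConj q p) : IsConj p q := by
  obtain ⟨m, hm⟩ := h
  refine ⟨-m, fun k => ?_⟩
  rw [hm k, ← mul_assoc, ← Complex.exp_add]
  push_cast
  rw [show 2 * (Real.pi : ℂ) * Complex.I * -m * k + 2 * Real.pi * Complex.I * m * k = 0 by ring]
  simp

theorem IsConj.trans {q p s : ExpFactor} (h : IsConj q p) (h' : IsConj p s) : IsConj q s := by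
  obtain ⟨m, hm⟩ := h
  obtain ⟨n, hn⟩ := h'
  refine ⟨n + m, fun k => ?_⟩
  rw [hn k, hm k, ← mul_assoc, ← Complex.exp_add]
  push_cast
  congr 2
  ring

theorem IsConj.exponents_eq {q p : ExpFactor} (h : IsConj q p) : q.exponents = p.exponents := by
  obtain ⟨m, hm⟩ := h
  ext k
  simp [exponents, hm k, Complex.exp_ne_zero]

theorem IsConj.trunc {q p : ExpFactor} (h : IsConj q p) (k : ℚ) :
    IsConj (q.trunc k) (p.trunc k) := by
  obtain ⟨m, hm⟩ := h
  refine ⟨m, fun l => ?_⟩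
  by_cases hl : k ≤ l <;> simp [ExpFactor.trunc, hl, hm l]

theorem IsConj.tail {q p : ExpFactor} (h : IsConj q p) (k : ℚ) :
    IsConj (q.tail k) (p.tail k) := by
  obtain ⟨m, hm⟩ := h
  refine ⟨m, fun l => ?_⟩
  by_cases hl : l < k <;> simp [ExpFactor.tail, hl, hm l]

theorem IsConj.ram_eq {q p : ExpFactor} (h : IsConj q p) : q.ram = p.ram := by
  simp [ram, HasDenominator, h.exponents_eq]

theorem IsConj.slope_eq {q p : ExpFactor} (h : IsConj q p) : q.slope = p.slope := by
  simp [slope, h.exponents_eq]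

/-- Galois conjugacy of exponential factors. -/
instance conjSetoid : Setoid ExpFactor where
  r := IsConj
  iseqv := ⟨IsConj.refl, IsConj.symm, IsConj.trans⟩

end ExpFactor

/-- A Stokes circle at infinity: a Galois orbit of exponential factors. -/
def StokesCircle : Type := Quotient ExpFactor.conjSetoid

/-- The Galois orbit `⟨q⟩`. -/
def ExpFactor.circle (q : ExpFactor) : StokesCircle := Quotient.mk _ q

/-- The ramification order of a Stokes circle. -/
def StokesCircle.ram (I : StokesCircle) : ℕ :=
  Quotient.lift ExpFactor.ram (fun _ _ h => ExpFactor.IsConj.ram_eq h) I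

/-- An irregular class at infinity `∑ n_i I_i`: a finite multiset of Stokes circles. -/
abbrev IrregularClass : Type := StokesCircle →₀ ℕ

/-- An irregular class is untwisted if each of its Stokes circles has ramification order `1`. -/
def IrregularClass.IsUntwisted (Θ : IrregularClass) : Prop := ∀ I ∈ Θ.support, I.ram = 1

/-! ### Loop and edge multiplicities of Stokes circles -/

/-- For `k ∈ (1/r) ℕ`, the natural number `m` with `k = m / r`. -/
def numer (r : ℕ) (k : ℚ) : ℕ := (r * k).num.natAbs

/-- `gcd (r, m_0, …, m_t)`, where `m_0 / r, …, m_t / r` are the elements of `E`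
(it is `r` if `E` is empty). -/
def gcdNumer (r : ℕ) (E : Finset ℚ) : ℕ := Nat.gcd r (E.gcd (numer r))

/-- For `E = {k_0 > … > k_t}` with `k_j = m_j / r = m'_j / r'`, this is
`∑ j, m_j * (gcd (r', m'_0, …, m'_{j-1}) - gcd (r', m'_0, …, m'_j))`,
where the first gcd is `r'` for `j = 0`. -/
def levelSum (r r' : ℕ) (E : Finset ℚ) : ℤ :=
  ∑ k ∈ E, (numer r k : ℤ) *
    ((gcdNumer r' (E.filter (fun l => k < l)) : ℤ) - gcdNumer r' (E.filter (fun l => k ≤ l)))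

namespace ExpFactor

/-- The loop multiplicity of `⟨q⟩` (it is `0` for `q = 0`). -/
def loopMult (q : ExpFactor) : ℤ := levelSum q.ram q.ram q.exponents - (q.ram : ℤ) ^ 2 + 1

/-- The least `l ∈ (1 / lcm (r, r')) ℤ_{>0}` such that the truncations `τ_l(q)` and `τ_l(q')` are
Galois conjugate; the common parts of `q` and `q'` are their truncations at this `l`. -/
def cutoff (q q' : ExpFactor) : ℚ :=
  (sInf {m : ℕ | 0 < m ∧ IsConj (q.trunc (m / (Nat.lcm q.ram q'.ram : ℕ)))
    (q'.trunc (m / (Nat.lcm q.ram q'.ram : ℕ)))} : ℕ) / (Nat.lcm q.ram q'.ram : ℕ)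

/-- The common part of `q` with `q'`. -/
def commonPart (q q' : ExpFactor) : ExpFactor := q.trunc (cutoff q q')

/-- The different part of `q` from `q'`: `q` minus its common part. -/
def diffPart (q q' : ExpFactor) : ExpFactor := q.tail (cutoff q q')

/-- The fission exponent of two exponential factors. -/
def fissionExponent (q q' : ExpFactor) : ℚ := max (diffPart q q').slope (diffPart q' q).slope

/-- The formula for the edge multiplicity in the case where the slope of the different part of `q`
is at least that of the different part of `q'`. -/
def edgeFormula (q q' : ExpFactor) : ℤ :=
  levelSum q.ram q'.ram (commonPart q q').exponents
    + (numer q.ram (fissionExponent q q') : ℤ) * gcdNumer q'.ram (commonPart q q').exponents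
    - (q.ram : ℤ) * q'.ram

/-- The edge multiplicity of two distinct Stokes circles `⟨q⟩` and `⟨q'⟩`. -/
def edgeMult (q q' : ExpFactor) : ℤ :=
  if (diffPart q' q).slope ≤ (diffPart q q').slope then edgeFormula q q' else edgeFormula q' q

theorem IsConj.loopMult_eq {q p : ExpFactor} (h : IsConj q p) : q.loopMult = p.loopMult := by
  simp [loopMult, h.exponents_eq, h.ram_eq]

theorem IsConj.cutoff_eq {q p q' p' : ExpFactor} (h : IsConj q p) (h' : IsConj q' p') :
    cutoff q q' = cutoff p p' := by
  have key : ∀ l : ℚ, IsConj (q.trunc l) (q'.trunc l) ↔ IsConj (p.trunc l) (p'.trunc l) :=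
    fun l => ⟨fun H => ((h.trunc l).symm.trans H).trans (h'.trunc l),
      fun H => ((h.trunc l).trans H).trans (h'.trunc l).symm⟩
  simp only [cutoff, h.ram_eq, h'.ram_eq, key]

theorem IsConj.slope_diffPart_eq {q p q' p' : ExpFactor} (h : IsConj q p) (h' : IsConj q' p') :
    (diffPart q q').slope = (diffPart p p').slope := by
  rw [diffPart, diffPart, h.cutoff_eq h']
  exact (h.tail _).slope_eq

theorem IsConj.edgeFormula_eq {q p q' p' : ExpFactor} (h : IsConj q p) (h' : IsConj q' p') :
    edgeFormula q q' = edgeFormula p p' := by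
  have hc : (commonPart q q').exponents = (commonPart p p').exponents := by
    rw [commonPart, commonPart, h.cutoff_eq h']
    exact (h.trunc _).exponents_eq
  simp only [edgeFormula, fissionExponent, hc, h.ram_eq, h'.ram_eq, h.slope_diffPart_eq h',
    h'.slope_diffPart_eq h]

theorem IsConj.edgeMult_eq {q p q' p' : ExpFactor} (h : IsConj q p) (h' : IsConj q' p') :
    edgeMult q q' = edgeMult p p' := by
  simp only [edgeMult, h.edgeFormula_eq h', h'.edgeFormula_eq h, h.slope_diffPart_eq h',
    h'.slope_diffPart_eq h]

end ExpFactor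

open Classical in
/-- The multiplicity `B_{I,J}` attached to a pair of Stokes circles: the loop multiplicity if
`I = J`, the edge multiplicity if `I ≠ J`. -/
def StokesCircle.mult (I J : StokesCircle) : ℤ :=
  if I = J then
    Quotient.lift ExpFactor.loopMult (fun _ _ h => ExpFactor.IsConj.loopMult_eq h) I
  else
    Quotient.lift₂ ExpFactor.edgeMult (fun _ _ _ _ h h' => ExpFactor.IsConj.edgeMult_eq h h') I J

/-- `Γ` is the core diagram `Γ_c(Θ)`: its vertices are identified with the distinct Stokes circles
of `Θ`, in such a way that the entries of `Γ` are the multiplicities of these circles. -/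
def Diagram.IsCoreDiagram {N : Type*} (Γ : Diagram N) (Θ : IrregularClass) : Prop :=
  ∃ e : N ≃ {I : StokesCircle // I ∈ Θ.support},
    ∀ i j, Γ.mult i j = StokesCircle.mult (e i).1 (e j).1

/-! ### Algebraic connections on the affine line and their irregular class at infinity -/

/-- An algebraic connection on the affine line with coordinate `z`: a vector bundle, i.e. a finitely
generated projective `ℂ[z]`-module `E`, with an additive map `∇ = ∇_{d/dz}` satisfying the
Leibniz rule. -/
structure AffineLineConnection where
  E : Type
  [addCommGroup : AddCommGroup E]
  [module : Module ℂ[X] E]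
  [finite : Module.Finite ℂ[X] E]
  [projective : Module.Projective ℂ[X] E]
  nabla : E →+ E
  leibniz : ∀ (f : ℂ[X]) (v : E), nabla (f • v) = derivative f • v + f • nabla v

attribute [instance] AffineLineConnection.addCommGroup AffineLineConnection.module
  AffineLineConnection.finite AffineLineConnection.projective

/-- The embedding `ℂ[z] → ℂ((t))`, where `z = t ^ (-r)`. -/
def atInfinity (r : ℕ) (f : ℂ[X]) : LaurentSeries ℂ :=
  aeval (HahnSeries.single (-(r : ℤ)) (1 : ℂ) : LaurentSeries ℂ) f

/-- The derivation `z d/dz = -(1/r) t d/dt` of `ℂ((t))`, where `z = t ^ (-r)`. -/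
def eulerDeriv (r : ℕ) (f : LaurentSeries ℂ) : LaurentSeries ℂ :=
  (-(r : ℂ)⁻¹) • ((HahnSeries.single (1 : ℤ) (1 : ℂ) : LaurentSeries ℂ)
    * LaurentSeries.derivative ℂ f)

/-- The exponential factor `∑ a_k z ^ k`, with exponents in `(1/r) ℤ`, as the element
`∑ a_k t ^ (-r k)` of `ℂ((t))`, where `z = t ^ (-r)`. -/
def ExpFactor.toLaurent (r : ℕ) (q : ExpFactor) : LaurentSeries ℂ :=
  q.coeff.sum (fun k a => HahnSeries.single (-(numer r k : ℤ)) a)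

/-- The matrix `A` of a connection in a basis `b`, so that `∇ = d/dz + A`. -/
def AffineLineConnection.connMatrix (V : AffineLineConnection) {n : ℕ}
    (b : Module.Basis (Fin n) ℂ[X] V.E) : Matrix (Fin n) (Fin n) ℂ[X] :=
  Matrix.of fun i j => b.repr (V.nabla (b j)) i

/-- `Θ` is the irregular class of `(E, ∇)` at infinity. This says that, after pullback to `ℂ((t))`
with `z = t ^ (-r)` for some `r ≥ 1`, the connection is isomorphic to a direct sum of
connections `(ℂ((t)), d - dq) ⊗ R_q` with `q` running through exponential factors and `R_q`
regular singular, and that each `q` has multiplicity `rank R_q = Θ ⟨q⟩`.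

Concretely there are a basis of `E` (in which `∇ = d/dz + A`) and exponential factors
`q 1, …, q n`, and the invertible matrix `G` is a change of basis over `ℂ((t))` after which
`z ∇` has the matrix `R - diag (z dq_i/dz)`, where `R` has entries in `ℂ[[t]]` and is
block-diagonal with respect to the distinct values of `q`. -/
def AffineLineConnection.HasIrregularClass (V : AffineLineConnection) (Θ : IrregularClass) :
    Prop :=
  ∃ (r n : ℕ) (b : Module.Basis (Fin n) ℂ[X] V.E) (q : Fin n → ExpFactor)
    (G : GL (Fin n) (LaurentSeries ℂ)) (R : Matrix (Fin n) (Fin n) (PowerSeries ℂ)),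
    1 ≤ r ∧
    (∀ i, (q i).HasDenominator r) ∧
    (∀ i j, q i ≠ q j → R i j = 0) ∧
    atInfinity r X • ((V.connMatrix b).map (atInfinity r) * G.1) + G.1.map (eulerDeriv r) =
      G.1 * (R.map (HahnSeries.ofPowerSeries ℤ ℂ) -
        Matrix.diagonal fun i => eulerDeriv r ((q i).toLaurent r)) ∧
    ∀ p : ExpFactor, Nat.card {i : Fin n // q i = p} = Θ p.circle

/-- A fission graph: the core diagram of an algebraic connection on the affine line whose irregular
class at infinity is untwisted. -/
def Diagram.IsFissionGraph {N : Type*} (Γ : Diagram N) : Prop :=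
  ∃ (V : AffineLineConnection) (Θ : IrregularClass),
    V.HasIrregularClass Θ ∧ Θ.IsUntwisted ∧ Γ.IsCoreDiagram Θ

end NAH

end

/-! An untwisted circle is a single polynomial without constant term, and `DifferTop.edgeMult_eq`
evaluates its edge multiplicities as B_ij = deg(q_i - q_j) - 1. Degree is non-archimedean
(`DifferTop.le_max`), so no B exceeds the maximum of the other two in its triangle: the two largest
agree. Conversely, the triangle condition makes "equal or B_ij < m" an equivalence relation for each
m, coarser as m grows. In `Diagram.exists_coeffs` the coefficient of z^k in q_i labels the class of
i for m = k - 1, so q_i and q_j agree in degree k exactly when k > B_ij + 1. The sum of the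
connections d - dq_i realises these exponential factors. -/

noncomputable section

namespace NAH

/-! ### Multiplicities of untwisted circles -/

namespace ExpFactor

theorem hasDenominator_one_of_ram_eq_one {q : ExpFactor} (h : q.ram = 1) : q.HasDenominator 1 := by
  -- In `ℕ` the infimum of the empty set is 0, so the value 1 must be attained.
  have hne : {r : ℕ | 1 ≤ r ∧ q.HasDenominator r}.Nonempty := by
    by_contra hempty
    rw [Set.not_nonempty_iff_eq_empty] at hempty
    simp [ram, hempty] at h
  have hmem := Nat.sInf_mem hne
  rw [show sInf {r : ℕ | 1 ≤ r ∧ q.HasDenominator r} = 1 from h] at hmem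
  exact hmem.2

theorem HasDenominator.ram_eq_one {q : ExpFactor} (h : q.HasDenominator 1) : q.ram = 1 :=
  have hmem : 1 ∈ {r : ℕ | 1 ≤ r ∧ q.HasDenominator r} := ⟨le_rfl, h⟩
  le_antisymm (Nat.sInf_le hmem) (Nat.sInf_mem ⟨1, hmem⟩).1

theorem HasDenominator.exists_natCast {q : ExpFactor} (h : q.HasDenominator 1) {k : ℚ}
    (hk : q.coeff k ≠ 0) : ∃ m : ℕ, k = m := by
  simpa using h k (Finsupp.mem_support_iff.2 hk)

/-- Continuation around infinity multiplies z^k by exp(2πimk), which is 1 for integral k. -/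
theorem HasDenominator.isConj_iff {q p : ExpFactor} (h : q.HasDenominator 1) :
    IsConj q p ↔ q = p := by
  refine ⟨fun ⟨m, hm⟩ => ?_, fun H => H ▸ IsConj.refl q⟩
  ext k
  rw [hm k]
  by_cases hk : q.coeff k = 0
  · simp [hk]
  · obtain ⟨l, rfl⟩ := h.exists_natCast hk
    have : Complex.exp (2 * Real.pi * Complex.I * m * ((l : ℚ) : ℂ)) = 1 :=
      Complex.exp_eq_one_iff.2 ⟨m * l, by push_cast; ring⟩
    rw [this, one_mul]

theorem HasDenominator.trunc {q : ExpFactor} {r : ℕ} (h : q.HasDenominator r) (l : ℚ) :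
    (q.trunc l).HasDenominator r := fun k hk => h k <| by
  simp only [exponents, ExpFactor.trunc, Finsupp.support_filter, Finset.mem_filter] at hk
  exact hk.1

theorem trunc_eq_trunc_iff {q p : ExpFactor} {l : ℚ} :
    q.trunc l = p.trunc l ↔ ∀ k, l ≤ k → q.coeff k = p.coeff k := by
  rw [ExpFactor.ext_iff, DFunLike.ext_iff]
  refine forall_congr' fun k => ?_
  by_cases hk : l ≤ k <;> simp [ExpFactor.trunc, hk]

/-- `D` is the largest exponent at which the coefficients of `q` and `p` differ. -/
def DifferTop (q p : ExpFactor) (D : ℕ) : Prop :=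
  q.coeff D ≠ p.coeff D ∧ ∀ k : ℚ, D < k → q.coeff k = p.coeff k

theorem DifferTop.symm {q p : ExpFactor} {D : ℕ} (h : DifferTop q p D) : DifferTop p q D :=
  ⟨h.1.symm, fun k hk => (h.2 k hk).symm⟩

/-- Above both a and b the coefficients of all three factors agree. -/
theorem DifferTop.le_max {q p s : ExpFactor} {a b c : ℕ} (hqp : DifferTop q p a)
    (hps : DifferTop p s b) (hqs : DifferTop q s c) : c ≤ max a b := by
  by_contra! hc
  obtain ⟨hac, hbc⟩ := max_lt_iff.1 hc
  exact hqs.1 ((hqp.2 c (by exact_mod_cast hac)).trans (hps.2 c (by exact_mod_cast hbc)))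

theorem HasDenominator.exists_differTop {q p : ExpFactor} (hq : q.HasDenominator 1)
    (hp : p.HasDenominator 1) (h : q ≠ p) : ∃ D, DifferTop q p D := by
  have hne : (q.coeff - p.coeff).support.Nonempty := by
    rw [Finsupp.support_nonempty_iff, sub_ne_zero]
    exact fun H => h (ExpFactor.ext H)
  have hmem := Finset.max'_mem _ hne
  generalize hd : (q.coeff - p.coeff).support.max' hne = d at hmem
  have hmax : ∀ k ∈ (q.coeff - p.coeff).support, k ≤ d := fun k hk => hd ▸ Finset.le_max' _ k hk
  simp only [Finsupp.mem_support_iff, Finsupp.sub_apply, sub_ne_zero] at hmem hmax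
  obtain ⟨D, rfl⟩ : ∃ D : ℕ, d = D := by
    by_cases hd : q.coeff d = 0
    · exact hp.exists_natCast (fun H => hmem (hd.trans H.symm))
    · exact hq.exists_natCast hd
  exact ⟨D, hmem, fun k hk => by_contra fun H => (hmax k H).not_gt hk⟩

theorem coeff_natCast_zero (q : ExpFactor) : q.coeff ((0 : ℕ) : ℚ) = 0 := by
  by_contra h
  simpa using q.pos _ (Finsupp.mem_support_iff.2 h)

theorem DifferTop.pos {q p : ExpFactor} {D : ℕ} (h : DifferTop q p D) : 0 < D := by
  rw [Nat.pos_iff_ne_zero]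
  rintro rfl
  exact h.1 (by rw [coeff_natCast_zero, coeff_natCast_zero])

/-- Conjugacy is equality here, and truncations at an integer m agree exactly when m > D. Cutting at
D + 1 leaves z^D in the different parts. -/
theorem DifferTop.cutoff_eq {q p : ExpFactor} {D : ℕ} (h : DifferTop q p D)
    (hq : q.HasDenominator 1) (hp : p.HasDenominator 1) : cutoff q p = D + 1 := by
  have hset : {m : ℕ | 0 < m ∧ IsConj (q.trunc (m / (Nat.lcm q.ram p.ram : ℕ)))
      (p.trunc (m / (Nat.lcm q.ram p.ram : ℕ)))} = Set.Ici (D + 1) := by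
    ext m
    rw [hq.ram_eq_one, hp.ram_eq_one]
    simp only [(hq.trunc _).isConj_iff, trunc_eq_trunc_iff, Set.mem_ofPred_eq, Set.mem_Ici,
      Nat.lcm_self, Nat.cast_one, div_one]
    refine ⟨fun ⟨_, hm⟩ => ?_, fun hm => ⟨by omega, fun k hk => h.2 k ?_⟩⟩
    · by_contra! hlt
      exact h.1 (hm D (by exact_mod_cast Nat.lt_succ_iff.1 hlt))
    · have : (D : ℚ) + 1 ≤ m := by exact_mod_cast hm
      linarith
  rw [cutoff, hset, csInf_Ici, hq.ram_eq_one, hp.ram_eq_one]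
  simp

theorem slope_tail_le {q : ExpFactor} (hq : q.HasDenominator 1) (D : ℕ) :
    (q.tail (D + 1)).slope ≤ D := by
  refine Finset.max'_le _ _ _ fun k hk => ?_
  rcases Finset.mem_insert.1 hk with rfl | hk
  · positivity
  · simp only [exponents, ExpFactor.tail, Finsupp.support_filter, Finset.mem_filter,
      Finsupp.mem_support_iff] at hk
    obtain ⟨m, rfl⟩ := hq.exists_natCast hk.1
    have := hk.2
    norm_cast at this ⊢
    omega

theorem slope_tail_eq {q : ExpFactor} (hq : q.HasDenominator 1) {D : ℕ} (hD : q.coeff D ≠ 0) :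
    (q.tail (D + 1)).slope = D := by
  refine le_antisymm (slope_tail_le hq D) (Finset.le_max' _ _ (Finset.mem_insert_of_mem ?_))
  simp [exponents, ExpFactor.tail, hD]

/-- At least one factor contains z^D, so its tail has slope D; integrality bounds the other tail's
slope by D. -/
theorem DifferTop.fissionExponent_eq {q p : ExpFactor} {D : ℕ} (h : DifferTop q p D)
    (hq : q.HasDenominator 1) (hp : p.HasDenominator 1) : fissionExponent q p = D := by
  rw [fissionExponent, diffPart, diffPart, h.cutoff_eq hq hp, h.symm.cutoff_eq hp hq]
  by_cases hD : q.coeff D = 0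
  · rw [slope_tail_eq hp fun H => h.1 (hD.trans H.symm), max_eq_right (slope_tail_le hq D)]
  · rw [slope_tail_eq hq hD, max_eq_left (slope_tail_le hp D)]

theorem gcdNumer_one (E : Finset ℚ) : gcdNumer 1 E = 1 := Nat.gcd_one_left _

/-- Every gcd with 1 is 1, so each difference vanishes. -/
theorem levelSum_one (r : ℕ) (E : Finset ℚ) : levelSum r 1 E = 0 := by
  simp [levelSum, gcdNumer_one]

theorem HasDenominator.loopMult_eq_zero {q : ExpFactor} (hq : q.HasDenominator 1) :
    q.loopMult = 0 := by
  simp [loopMult, hq.ram_eq_one, levelSum_one]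

theorem DifferTop.edgeFormula_eq {q p : ExpFactor} {D : ℕ} (h : DifferTop q p D)
    (hq : q.HasDenominator 1) (hp : p.HasDenominator 1) : edgeFormula q p = D - 1 := by
  simp [edgeFormula, hq.ram_eq_one, hp.ram_eq_one, levelSum_one, gcdNumer_one,
    h.fissionExponent_eq hq hp, numer]

/-- For untwisted circles the edge multiplicity is `deg (q - p) - 1`. -/
theorem DifferTop.edgeMult_eq {q p : ExpFactor} {D : ℕ} (h : DifferTop q p D)
    (hq : q.HasDenominator 1) (hp : p.HasDenominator 1) : edgeMult q p = D - 1 := by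
  rw [edgeMult, h.edgeFormula_eq hq hp, h.symm.edgeFormula_eq hp hq, ite_self]

theorem circle_eq_circle_iff {q p : ExpFactor} : q.circle = p.circle ↔ IsConj q p :=
  Quotient.eq

theorem mult_circle_self (q : ExpFactor) : StokesCircle.mult q.circle q.circle = q.loopMult := by
  rw [StokesCircle.mult, if_pos rfl]
  rfl

theorem mult_circle_of_ne {q p : ExpFactor} (h : q.circle ≠ p.circle) :
    StokesCircle.mult q.circle p.circle = edgeMult q p := by
  rw [StokesCircle.mult, if_neg h]
  rfl

end ExpFactor

/-! ### Necessity: the ultrametric inequality -/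

open ExpFactor

theorem Diagram.IsFissionGraph.isAcuteIsosceles {N : Type*} {Γ : Diagram N}
    (h : Γ.IsFissionGraph) {i j k : N} (hij : i ≠ j) (hjk : j ≠ k) (hik : i ≠ k) :
    Γ.IsAcuteIsosceles i j k := by
  obtain ⟨V, Θ, -, hΘ, e, he⟩ := h
  have hrep : ∀ i, ∃ q : ExpFactor, q.circle = (e i).1 ∧ q.HasDenominator 1 := fun i => by
    obtain ⟨q, hq⟩ := Quotient.exists_rep (e i).1
    have hram := hΘ _ (e i).2
    rw [← hq] at hram
    exact ⟨q, hq, hasDenominator_one_of_ram_eq_one hram⟩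
  choose q hq hden using hrep
  have hedge : ∀ {i j}, i ≠ j → ∃ D, DifferTop (q i) (q j) D ∧ Γ.mult i j = D - 1 := by
    intro i j hij
    have hne : (q i).circle ≠ (q j).circle := by
      rw [hq, hq]
      exact fun H => hij (e.injective (Subtype.ext H))
    obtain ⟨D, hD⟩ := (hden i).exists_differTop (hden j) fun H => hne (H ▸ rfl)
    exact ⟨D, hD, by rw [he, ← hq, ← hq, mult_circle_of_ne hne, hD.edgeMult_eq (hden i) (hden j)]⟩
  obtain ⟨a, ha, hma⟩ := hedge hij
  obtain ⟨b, hb, hmb⟩ := hedge hjk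
  obtain ⟨c, hc, hmc⟩ := hedge hik
  -- Each of the three degrees is at most the maximum of the other two.
  have h₁ := ha.le_max hb hc
  have h₂ := ha.symm.le_max hc hb
  have h₃ := hc.le_max hb.symm ha
  rw [Diagram.IsAcuteIsosceles, hma, hmb, hmc]
  omega

/-! ### Direct sums of connections of rank one -/

/-- The direct sum of the rank one connections `d - p i dz`. -/
def AffineLineConnection.diagonal {n : ℕ} (p : Fin n → ℂ[X]) : AffineLineConnection where
  E := Fin n → ℂ[X]
  nabla :=
    { toFun := fun v i => derivative (v i) - p i * v i
      map_zero' := by ext; simp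
      map_add' := fun v w => by
        ext1 i
        simp only [Pi.add_apply, derivative_add]
        ring }
  leibniz f v := by
    ext1 i
    simp only [AddMonoidHom.coe_mk, ZeroHom.coe_mk, Pi.add_apply, Pi.smul_apply, smul_eq_mul,
      derivative_mul]
    ring

theorem AffineLineConnection.connMatrix_diagonal {n : ℕ} (p : Fin n → ℂ[X]) :
    (AffineLineConnection.diagonal p).connMatrix (Pi.basisFun ℂ[X] (Fin n)) =
      Matrix.diagonal (-p) := by
  ext1 i j
  change derivative (Pi.basisFun ℂ[X] (Fin n) j i) - p i * Pi.basisFun ℂ[X] (Fin n) j i = _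
  rcases eq_or_ne i j with rfl | h
  · simp
  · simp [h]

theorem atInfinity_one_monomial (k : ℕ) (a : ℂ) :
    atInfinity 1 (monomial k a) = HahnSeries.single (-(k : ℤ)) a := by
  rw [atInfinity, aeval_monomial, HahnSeries.single_pow, HahnSeries.algebraMap_apply',
    PowerSeries.algebraMap_apply, HahnSeries.ofPowerSeries_C, HahnSeries.C_apply]
  simp [HahnSeries.single_mul_single]

theorem eulerDeriv_one_single (k : ℤ) (a : ℂ) :
    eulerDeriv 1 (HahnSeries.single k a) = HahnSeries.single k (-k * a) := by
  rw [eulerDeriv, LaurentSeries.derivative_apply, LaurentSeries.hasseDeriv_single,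
    HahnSeries.single_mul_single]
  ext m
  rw [HahnSeries.coeff_smul]
  by_cases hm : m = k <;> simp [hm]

theorem eulerDeriv_add (r : ℕ) (f g : LaurentSeries ℂ) :
    eulerDeriv r (f + g) = eulerDeriv r f + eulerDeriv r g := by
  rw [eulerDeriv, map_add, mul_add, smul_add]
  rfl

theorem eulerDeriv_zero (r : ℕ) : eulerDeriv r 0 = 0 := by
  simp [eulerDeriv]

theorem eulerDeriv_one_one : eulerDeriv 1 1 = 0 := by
  rw [← HahnSeries.single_zero_one, eulerDeriv_one_single]
  simp

/-- This is z d/dz P = zP' at infinity; additivity reduces it to monomials. -/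
theorem eulerDeriv_one_atInfinity (P : ℂ[X]) :
    eulerDeriv 1 (atInfinity 1 P) = atInfinity 1 X * atInfinity 1 (derivative P) := by
  have hmul : ∀ p q : ℂ[X], atInfinity 1 (p * q) = atInfinity 1 p * atInfinity 1 q := map_mul _
  rw [← hmul]
  induction P using Polynomial.induction_on' with
  | add p q hp hq =>
    have hadd : ∀ p q : ℂ[X], atInfinity 1 (p + q) = atInfinity 1 p + atInfinity 1 q :=
      map_add _
    rw [hadd, eulerDeriv_add, hp, hq, derivative_add, mul_add, hadd]
  | monomial k a =>
    rw [atInfinity_one_monomial, eulerDeriv_one_single, derivative_monomial, X_mul_monomial]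
    rcases k with _ | k
    · simp [atInfinity]
    · rw [Nat.add_sub_cancel, atInfinity_one_monomial]
      congr 1
      push_cast
      ring

/-- The exponential factors of `⨁ (ℂ[z], d - dq_i)` are the `q_i`. -/
theorem AffineLineConnection.hasIrregularClass_diagonal {n : ℕ} (P : Fin n → ℂ[X])
    (q : Fin n → ExpFactor) (hq : ∀ i, (q i).HasDenominator 1)
    (hP : ∀ i, (q i).toLaurent 1 = atInfinity 1 (P i)) (Θ : IrregularClass)
    (hΘ : ∀ p : ExpFactor, Nat.card {i : Fin n // q i = p} = Θ p.circle) :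
    (AffineLineConnection.diagonal fun i => derivative (P i)).HasIrregularClass Θ := by
  -- The connection is already diagonal: no ramification, trivial gauge, zero regular part.
  refine ⟨1, n, Pi.basisFun ℂ[X] (Fin n), q, 1, 0, le_rfl, hq, fun _ _ _ => rfl, ?_, hΘ⟩
  ext1 i j
  rw [AffineLineConnection.connMatrix_diagonal]
  rcases eq_or_ne i j with rfl | h
  · have hneg : ∀ p : ℂ[X], atInfinity 1 (-p) = -atInfinity 1 p := map_neg _
    have hmap : ∀ p q : ℂ[X], atInfinity 1 (p * q) = atInfinity 1 p * atInfinity 1 q :=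
      map_mul _
    have hmul : ∀ p : ℂ[X], atInfinity 1 X * -atInfinity 1 p = -(atInfinity 1 X * atInfinity 1 p) :=
      fun p => by rw [← hneg, ← hmap, ← hmap, ← hneg, mul_neg]
    simp [hP, eulerDeriv_one_atInfinity, eulerDeriv_one_one, hneg]
    exact hmul _
  · have hzero : atInfinity 1 0 = 0 := map_zero _
    simp [h, eulerDeriv_zero, hzero]

/-! ### Exponential factors with prescribed coefficients -/

/-- The exponential factor `∑ a_k z ^ k`, the sum being over `1 ≤ k ≤ M`. -/
def ExpFactor.ofCoeffs (M : ℕ) (a : ℕ → ℂ) : ExpFactor where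
  coeff := ∑ k ∈ Finset.Icc 1 M, Finsupp.single (k : ℚ) (a k)
  pos l hl := by
    obtain ⟨k, hk, hkl⟩ := Finset.mem_biUnion.1 (Finsupp.support_finsetSum hl)
    rw [Finset.mem_singleton.1 (Finsupp.support_single_subset hkl)]
    exact_mod_cast (Finset.mem_Icc.1 hk).1

namespace ExpFactor

theorem coeff_ofCoeffs (M : ℕ) (a : ℕ → ℂ) (l : ℚ) :
    (ofCoeffs M a).coeff l = ∑ k ∈ Finset.Icc 1 M, if (k : ℚ) = l then a k else 0 := by
  simp [ofCoeffs, Finsupp.single_apply]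

theorem coeff_ofCoeffs_natCast {M k : ℕ} (a : ℕ → ℂ) (hk : k ∈ Finset.Icc 1 M) :
    (ofCoeffs M a).coeff k = a k := by
  simp only [coeff_ofCoeffs, Nat.cast_inj]
  rw [Finset.sum_ite_eq', if_pos hk]

theorem hasDenominator_ofCoeffs (M : ℕ) (a : ℕ → ℂ) : (ofCoeffs M a).HasDenominator 1 := by
  intro l hl
  obtain ⟨k, -, hkl⟩ := Finset.mem_biUnion.1 (Finsupp.support_finsetSum hl)
  exact ⟨k, by simpa using Finset.mem_singleton.1 (Finsupp.support_single_subset hkl)⟩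

theorem toLaurent_ofCoeffs (M : ℕ) (a : ℕ → ℂ) :
    (ofCoeffs M a).toLaurent 1 = atInfinity 1 (∑ k ∈ Finset.Icc 1 M, monomial k (a k)) := by
  rw [toLaurent, ofCoeffs, ← Finsupp.sum_finsetSum_index (fun _ => HahnSeries.single_eq_zero)
    (fun _ _ _ => map_add (HahnSeries.single.addMonoidHom _) _ _)]
  have hsum : atInfinity 1 (∑ k ∈ Finset.Icc 1 M, monomial k (a k)) =
    ∑ k ∈ Finset.Icc 1 M, atInfinity 1 (monomial k (a k)) := map_sum _ _ _
  rw [hsum]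
  refine Finset.sum_congr rfl fun k _ => ?_
  rw [Finsupp.sum_single_index HahnSeries.single_eq_zero, atInfinity_one_monomial]
  simp [numer]

theorem differTop_ofCoeffs {M D : ℕ} {a b : ℕ → ℂ} (hD : D ∈ Finset.Icc 1 M) (hne : a D ≠ b D)
    (heq : ∀ k, D < k → a k = b k) : DifferTop (ofCoeffs M a) (ofCoeffs M b) D := by
  refine ⟨by rwa [coeff_ofCoeffs_natCast a hD, coeff_ofCoeffs_natCast b hD], fun l hl => ?_⟩
  rw [coeff_ofCoeffs, coeff_ofCoeffs]
  refine Finset.sum_congr rfl fun k _ => ?_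
  split_ifs with h
  · exact heq k (by rw [← h] at hl; exact_mod_cast hl)
  · rfl

end ExpFactor

/-! ### Sufficiency: polynomials from nested partitions -/

theorem Diagram.mult_comm {N : Type*} (Γ : Diagram N) (i j : N) : Γ.mult i j = Γ.mult j i :=
  Γ.symm.apply j i

/-- In a graph with acute isosceles triangles, being equal or joined by fewer than `m` edges is an
equivalence relation. -/
def Diagram.setoidOfAcuteIsosceles {N : Type*} (Γ : Diagram N)
    (h : ∀ i j k : N, i ≠ j → j ≠ k → i ≠ k → Γ.IsAcuteIsosceles i j k) (m : ℤ) : Setoid N where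
  r i j := i = j ∨ Γ.mult i j < m
  iseqv :=
    { refl := fun _ => Or.inl rfl
      symm := fun {i j} hij => hij.imp Eq.symm fun H => Γ.mult_comm i j ▸ H
      trans := fun {i j k} hij hjk => by
        rcases hij with rfl | hij
        · exact hjk
        rcases hjk with rfl | hjk
        · exact Or.inr hij
        by_cases h₁ : i = j
        · exact Or.inr (h₁ ▸ hjk)
        by_cases h₂ : j = k
        · exact Or.inr (h₂ ▸ hij)
        by_cases h₃ : i = k
        · exact Or.inl h₃
        have := h i j k h₁ h₂ h₃
        rw [Diagram.IsAcuteIsosceles] at this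
        right
        omega }

/-- Polynomials `q_i` with `deg (q_i - q_j) = B_ij + 1`. -/
theorem Diagram.exists_coeffs {N : Type*} [Finite N] (Γ : Diagram N) (hΓ : Γ.IsGraph)
    (h : ∀ i j k : N, i ≠ j → j ≠ k → i ≠ k → Γ.IsAcuteIsosceles i j k) :
    ∃ (M : ℕ) (a : N → ℕ → ℂ), ∀ i j, i ≠ j → ∃ D : ℕ, Γ.mult i j = D - 1 ∧
      DifferTop (ofCoeffs M (a i)) (ofCoeffs M (a j)) D := by
  obtain ⟨f, hf⟩ : ∃ f : N → ℂ, Function.Injective f :=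
    ⟨_, (Nat.cast_injective.comp Fin.val_injective).comp (Finite.equivFin N).injective⟩
  -- M bounds all multiplicities, so degrees up to M + 1 suffice.
  obtain ⟨M, hM⟩ := (Set.finite_range fun x : N × N => (Γ.mult x.1 x.2).toNat).bddAbove
  let s : ℕ → Setoid N := fun k => Γ.setoidOfAcuteIsosceles h (k - 1)
  -- A class is labelled by the image under `f` of its chosen representative.
  let a : N → ℕ → ℂ := fun i k => f (Quotient.mk (s k) i).out
  have ha : ∀ i j k, a i k = a j k ↔ i = j ∨ Γ.mult i j < k - 1 := fun i j k =>
    (hf.eq_iff.trans Quotient.out_inj).trans Quotient.eq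
  refine ⟨M + 1, a, fun i j hij => ⟨(Γ.mult i j).toNat + 1, ?_, differTop_ofCoeffs ?_ ?_ ?_⟩⟩
  · have := hΓ.1 i j
    omega
  · have : (Γ.mult i j).toNat ≤ M := hM ⟨(i, j), rfl⟩
    rw [Finset.mem_Icc]
    omega
  -- At k = B_ij + 1 the strict inequality B_ij < k - 1 just fails.
  · rw [Ne, ha]
    have := hΓ.1 i j
    simp [hij, this]
  · intro k hk
    rw [ha]
    omega

theorem Diagram.isFissionGraph_of_isAcuteIsosceles {N : Type*} [Finite N] (Γ : Diagram N)
    (hΓ : Γ.IsGraph) (h : ∀ i j k : N, i ≠ j → j ≠ k → i ≠ k → Γ.IsAcuteIsosceles i j k) :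
    Γ.IsFissionGraph := by
  classical
  obtain ⟨M, a, ha⟩ := Γ.exists_coeffs hΓ h
  let q : N → ExpFactor := fun i => ofCoeffs M (a i)
  have hq : ∀ i, (q i).HasDenominator 1 := fun i => hasDenominator_ofCoeffs M (a i)
  have hinj : Function.Injective q := fun i j hij => by
    by_contra hne
    obtain ⟨D, -, hD⟩ := ha i j hne
    exact hD.1 (congrArg (fun p => p.coeff D) hij)
  have hcirc : ∀ i p, (q i).circle = p.circle ↔ q i = p := fun i p =>
    circle_eq_circle_iff.trans (hq i).isConj_iff
  have hcinj : Function.Injective fun i => (q i).circle := fun i j hij =>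
    hinj ((hcirc i (q j)).1 hij)
  have := Fintype.ofFinite N
  let ε := Finite.equivFin N
  let Θ : IrregularClass := Finsupp.indicator (Finset.univ.image fun i => (q i).circle)
    fun _ _ => 1
  have hmem : ∀ I, I ∈ Θ.support ↔ I ∈ Set.range fun i => (q i).circle := fun I => by
    simp [Θ, Finsupp.indicator_apply]
  refine ⟨_, Θ, AffineLineConnection.hasIrregularClass_diagonal
    (fun i => ∑ k ∈ Finset.Icc 1 M, monomial k (a (ε.symm i) k)) (fun i => q (ε.symm i))
    (fun i => hq _) (fun i => toLaurent_ofCoeffs M _) Θ fun p => ?_, fun I hI => ?_,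
    (Equiv.ofInjective _ hcinj).trans (Equiv.subtypeEquivRight fun I => (hmem I).symm),
    fun i j => ?_⟩
  -- An untwisted orbit has one element, so both counts are 1 if p is some q_i and 0 otherwise.
  · by_cases hp : ∃ i, q i = p
    · obtain ⟨i, rfl⟩ := hp
      have : Unique {j // q (ε.symm j) = q i} :=
        ⟨⟨⟨ε i, by simp⟩⟩, fun ⟨j, hj⟩ => Subtype.ext (by simp [← hinj hj])⟩
      rw [Nat.card_unique]
      simp [Θ, Finsupp.indicator_apply]
    · have : IsEmpty {j // q (ε.symm j) = p} := ⟨fun ⟨j, hj⟩ => hp ⟨_, hj⟩⟩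
      rw [Nat.card_of_isEmpty]
      simpa [Θ, Finsupp.indicator_apply, hcirc] using hp
  · obtain ⟨i, rfl⟩ := (hmem I).1 hI
    exact (hq i).ram_eq_one
  · change _ = StokesCircle.mult (q i).circle (q j).circle
    rcases eq_or_ne i j with rfl | hij
    · rw [mult_circle_self, (hq i).loopMult_eq_zero, hΓ.2]
    · obtain ⟨D, hB, hD⟩ := ha i j hij
      rw [mult_circle_of_ne (hcinj.ne hij), hD.edgeMult_eq (hq i) (hq j), hB]

end NAH

end

theorem theorem3p2 {N : Type*} [Finite N] (Γ : NAH.Diagram N) (hΓ : Γ.IsGraph) :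
    Γ.IsFissionGraph ↔
      ∀ i j k : N, i ≠ j → j ≠ k → i ≠ k → Γ.IsAcuteIsosceles i j k :=
  ⟨fun h _ _ _ => h.isAcuteIsosceles, Γ.isFissionGraph_of_isAcuteIsosceles hΓ⟩
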